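/- For a finite abelian group $G$, a set $\Gamma$ of homomorphisms $\gamma : G \to \mathbb{C}^\times$ and a real number $\delta \ge 0$, the Bohr set of rank $|\Gamma|$ and radius $\delta$ determined by $\Gamma$ is $$\mathrm{Bohr}_G(\Gamma,\delta) = \{x \in G : |\gamma(x) - 1| \le \delta \text{ for all } \gamma \in \Gamma\}.$$ **Theorem.** There are absolute constants $c, C > 0$ such that the following holds. Let $G$ be a finite abelian group and let $A \subset G$ be a non-empty subset of size $\alpha |G|$. Then $2A - 2A = \{a_1 + a_2 - a_3 - a_4 : a_1, a_2, a_3, a_4 \in A\}$ contains a Bohr set $\mathrm{Bohr}_G(\Gamma,\delta)$ of radius $\delta \ge c\,\alpha^{1/2}$ and rank $|\Gamma| \le C\,(\log (1/\alpha))^4$. -/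

import Mathlib

open scoped Pointwise

/-- The Bohr set of the set of characters `Γ` and radius `δ` in the abelian group `G`:
all `x` with `|γ(x) - 1| ≤ δ` for every `γ ∈ Γ`. Its rank is `Γ.card`.
The homomorphisms from `G` to the nonzero complex numbers are Mathlib's `AddChar G ℂ`. -/
def bohrSet {G : Type*} [AddCommGroup G] (Γ : Finset (AddChar G ℂ)) (δ : ℝ) : Set G :=
  {x : G | ∀ γ ∈ Γ, ‖γ x - 1‖ ≤ δ}

/-! Write ρ = |G|/|A| = 1/α, L = log ρ, and let f be the indicator of A - A. The average of f(x + t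
- t') over t, t' ∈ A is 1 at x = 0 and vanishes off 2A - 2A, so it suffices to keep it positive on a
Bohr set. Sampling (`exists_almostPeriods`): n random translates approximate this average uniformly
to within l once l²n is about log ρ. The cost is log ρ rather than log |G| because one of the two
averages over A is kept exact. Hence a set X of density at least ρ⁻ⁿ/2 has all its differences as
almost-periods. Smoothing: averaging k times over X - X changes the function by at most 2kl, and
multiplies its Fourier coefficients by the 2k-th power of those of X. With k about L, the characters
outside the 1/2-spectrum of X become negligible. By Chang's inequality the spectrum lies in the span
of about log(|G|/|X|) ≲ nL characters. Taking l about 1/k gives n about L³ and rank about L⁴. -/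

/-! ### Exponential moments and Markov's inequality. -/

/-- Convexity of the exponential on `[-1, 1]`. -/
lemma exp_mul_le_cosh_add_mul_sinh_of_abs_le {u : ℝ} (hu : |u| ≤ 1) (l : ℝ) :
    Real.exp (l * u) ≤ Real.cosh l + u * Real.sinh l := by
  obtain ⟨h1, h2⟩ := abs_le.1 hu
  have h := convexOn_exp.2 (Set.mem_univ l) (Set.mem_univ (-l))
    (by linarith : 0 ≤ (1 + u) / 2) (by linarith : 0 ≤ (1 - u) / 2) (by ring)
  simp only [smul_eq_mul] at h
  rw [Real.cosh_eq, Real.sinh_eq]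
  calc _ = Real.exp ((1 + u) / 2 * l + (1 - u) / 2 * -l) := by congr 1; ring
    _ ≤ _ := h
    _ = _ := by ring

/-- Jensen's inequality for the exponential and a uniform average. -/
lemma exp_sum_div_card_le {ι : Type*} {B : Finset ι} (hB : B.Nonempty) (w : ι → ℝ) :
    Real.exp ((∑ b ∈ B, w b) / B.card) ≤ (∑ b ∈ B, Real.exp (w b)) / B.card := by
  have hc : (0 : ℝ) < B.card := by exact_mod_cast hB.card_pos
  have h := convexOn_exp.map_sum_le (t := B) (w := fun _ ↦ (B.card : ℝ)⁻¹) (p := w)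
    (fun _ _ ↦ by positivity) (by simp [hc.ne']) (fun _ _ ↦ Set.mem_univ _)
  simp only [smul_eq_mul, ← Finset.mul_sum] at h
  rwa [div_eq_inv_mul, div_eq_inv_mul]

/-- Hoeffding's exponential moment bound for independent uniform samples from `A`. -/
lemma sum_exp_mul_sum_le {ι : Type*} (A : Finset ι) {u : ι → ℝ} (hu : ∀ a, |u a| ≤ 1)
    (h0 : ∑ a ∈ A, u a = 0) (n : ℕ) (l : ℝ) :
    ∑ z ∈ Fintype.piFinset (fun _ : Fin n ↦ A), Real.exp (l * ∑ i, u (z i)) ≤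
      (A.card : ℝ) ^ n * Real.exp (l ^ 2 * n / 2) := by
  have h1 : ∑ a ∈ A, Real.exp (l * u a) ≤ A.card * Real.exp (l ^ 2 / 2) := by
    calc _ ≤ ∑ a ∈ A, (Real.cosh l + u a * Real.sinh l) :=
          Finset.sum_le_sum fun a _ ↦ exp_mul_le_cosh_add_mul_sinh_of_abs_le (hu a) l
      _ = A.card * Real.cosh l := by
          rw [Finset.sum_add_distrib, ← Finset.sum_mul, h0]; simp
      _ ≤ _ := by gcongr; exact Real.cosh_le_exp_half_sq l
  calc _ = ∑ z ∈ Fintype.piFinset (fun _ : Fin n ↦ A), ∏ i, Real.exp (l * u (z i)) := by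
        simp_rw [Finset.mul_sum, Real.exp_sum]
    _ = (∑ a ∈ A, Real.exp (l * u a)) ^ n := by
        rw [Finset.sum_prod_piFinset A (fun (_ : Fin n) a ↦ Real.exp (l * u a))]; simp
    _ ≤ (A.card * Real.exp (l ^ 2 / 2)) ^ n := by
        gcongr
    _ = _ := by rw [mul_pow, ← Real.exp_nat_mul]; congr 2; ring

/-- Markov's inequality: at least half of the points of `S` have value at most twice the mean. -/
lemma card_le_two_mul_card_filter {ι : Type*} [DecidableEq ι] (S : Finset ι) (v : ι → ℝ)
    (hv : ∀ z, 0 ≤ v z) {M : ℝ} (hM : 0 < M) (h : ∑ z ∈ S, v z ≤ S.card * M) :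
    (S.card : ℝ) ≤ 2 * (S.filter fun z ↦ v z ≤ 2 * M).card := by
  have h1 : ((S.filter fun z ↦ ¬ v z ≤ 2 * M).card : ℝ) * (2 * M) ≤ S.card * M := by
    calc _ = ∑ z ∈ S.filter (fun z ↦ ¬ v z ≤ 2 * M), 2 * M := by simp
      _ ≤ ∑ z ∈ S.filter (fun z ↦ ¬ v z ≤ 2 * M), v z :=
          Finset.sum_le_sum fun z hz ↦ (not_le.1 (Finset.mem_filter.1 hz).2).le
      _ ≤ ∑ z ∈ S, v z :=
          Finset.sum_le_sum_of_subset_of_nonneg (Finset.filter_subset _ _) fun z _ _ ↦ hv z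
      _ ≤ _ := h
  have h2 : ((S.filter fun z ↦ v z ≤ 2 * M).card : ℝ) +
      (S.filter fun z ↦ ¬ v z ≤ 2 * M).card = S.card := by
    exact_mod_cast Finset.card_filter_add_card_filter_not (s := S) (fun z ↦ v z ≤ 2 * M)
  nlinarith

/-! ### Random sampling and almost-periods. -/

section
variable {G : Type*} [AddCommGroup G] [Fintype G] [DecidableEq G]

/-- The average of `u (x + t - t')` over `t, t' ∈ X`. -/
noncomputable def diffAvg (X : Finset G) (u : G → ℝ) (x : G) : ℝ :=
  (∑ t ∈ X, ∑ t' ∈ X, u (x + t - t')) / (X.card : ℝ) ^ 2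

/-- Most samples `z ∈ A ^ n` approximate `diffAvg A f` uniformly. -/
lemma exists_uniform_samples {A : Finset G} (hA : A.Nonempty) {f : G → ℝ}
    (hf0 : ∀ x, 0 ≤ f x) (hf1 : ∀ x, f x ≤ 1) {n : ℕ} (hn : 0 < n) {l : ℝ} (hl : 0 < l)
    (hnl : 2 * Real.log (4 * (Fintype.card G / A.card)) ≤ l ^ 2 * n) :
    ∃ Z : Finset (Fin n → G), (A.card : ℝ) ^ n ≤ 2 * Z.card ∧ ∀ z ∈ Z, ∀ x,
      |(∑ b ∈ A, ∑ i, f (x + z i - b)) / (n * A.card) - diffAvg A f x| ≤ l := by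
  have hc : (0 : ℝ) < A.card := by exact_mod_cast hA.card_pos
  have hG : (0 : ℝ) < Fintype.card G := by exact_mod_cast Fintype.card_pos
  have hn' : (0 : ℝ) < n := by exact_mod_cast hn
  set F : G → ℝ := fun y ↦ (∑ a ∈ A, f (y + a)) / A.card with hF
  have hF0 : ∀ y, 0 ≤ F y := fun y ↦ div_nonneg (Finset.sum_nonneg fun _ _ ↦ hf0 _) hc.le
  have hF1 : ∀ y, F y ≤ 1 := fun y ↦ by
    rw [hF]; simp only; rw [div_le_one hc]
    simpa using Finset.sum_le_sum (s := A) fun a _ ↦ hf1 (y + a)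
  set v : G → (Fin n → G) → ℝ := fun y z ↦ ∑ i, (f (y + z i) - F y) with hv
  set S := Fintype.piFinset (fun _ : Fin n ↦ A) with hS
  have hScard : (S.card : ℝ) = (A.card : ℝ) ^ n := by simp [hS]
  set E := Real.exp (l ^ 2 * n / 2) with hE
  have hu : ∀ y a, |f (y + a) - F y| ≤ 1 := fun y a ↦ abs_le.2
    ⟨by linarith [hf0 (y + a), hF1 y], by linarith [hf1 (y + a), hF0 y]⟩
  have hmean : ∀ y, ∑ a ∈ A, (f (y + a) - F y) = 0 := fun y ↦ by
    rw [Finset.sum_sub_distrib]; simp [hF]; field_simp; simp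
  have hmom : ∀ y (s : ℝ), s ^ 2 = l ^ 2 →
      ∑ z ∈ S, Real.exp (s * v y z) ≤ S.card * E := fun y s hs ↦ by
    have := sum_exp_mul_sum_le A (hu y) (hmean y) n s
    rwa [hs, ← hScard] at this
  set W : (Fin n → G) → ℝ := fun z ↦
    ∑ y, (Real.exp (l * v y z) + Real.exp (-l * v y z)) with hW
  -- The mean of `W` over `S` is at most `|G| * 2E`: one term `E` for each point y and each sign.
  refine ⟨S.filter fun z ↦ W z ≤ 2 * (Fintype.card G * (2 * E)), ?_, ?_⟩
  · rw [← hScard]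
    refine card_le_two_mul_card_filter S W (fun z ↦ by positivity) (by positivity) ?_
    rw [hW, Finset.sum_comm]
    calc _ ≤ ∑ _y : G, (S.card * E + S.card * E) := by
          refine Finset.sum_le_sum fun y _ ↦ ?_
          rw [Finset.sum_add_distrib]
          exact add_le_add (hmom y l rfl) (hmom y (-l) (by ring))
      _ = _ := by simp; ring
  · intro z hz x
    have hz := (Finset.mem_filter.1 hz).2
    have key : ∀ s : ℝ, (s = l ∨ s = -l) →
        s * ((∑ b ∈ A, v (x - b) z) / A.card) ≤ l ^ 2 * n := by
      intro s hs
      have h1 : Real.exp (s * ((∑ b ∈ A, v (x - b) z) / A.card)) ≤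
          (4 * (Fintype.card G / A.card)) * E := by
        calc _ = Real.exp ((∑ b ∈ A, s * v (x - b) z) / A.card) := by
              rw [← Finset.mul_sum]; congr 1; ring
          _ ≤ (∑ b ∈ A, Real.exp (s * v (x - b) z)) / A.card := exp_sum_div_card_le hA _
          _ ≤ W z / A.card := by
              gcongr
              calc _ = ∑ y ∈ A.image (fun b ↦ x - b), Real.exp (s * v y z) := by
                    rw [Finset.sum_image]; intro a _ b _ h; simpa using h
                _ ≤ ∑ y, Real.exp (s * v y z) :=
                    Finset.sum_le_sum_of_subset_of_nonneg (Finset.subset_univ _)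
                      fun _ _ _ ↦ (Real.exp_pos _).le
                _ ≤ _ := by
                    refine Finset.sum_le_sum fun y _ ↦ ?_
                    rcases hs with rfl | rfl
                    · linarith [Real.exp_pos (-s * v y z)]
                    · linarith [Real.exp_pos (l * v y z)]
          _ ≤ 2 * (Fintype.card G * (2 * E)) / A.card := by gcongr
          _ = _ := by ring
      have h2 := (Real.le_log_iff_exp_le (by positivity)).2 h1
      rw [Real.log_mul (by positivity) (by positivity), hE, Real.log_exp] at h2
      linarith
    have e1 : (∑ b ∈ A, ∑ i, f (x + z i - b)) / (n * A.card) - diffAvg A f x =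
        ((∑ b ∈ A, v (x - b) z) / A.card) / n := by
      have : ∑ b ∈ A, v (x - b) z =
          ∑ b ∈ A, ∑ i, f (x + z i - b) - n * ∑ b ∈ A, F (x - b) := by
        rw [Finset.mul_sum, ← Finset.sum_sub_distrib]
        refine Finset.sum_congr rfl fun b _ ↦ ?_
        simp only [hv, Finset.sum_sub_distrib, Finset.sum_const, Finset.card_univ,
          Fintype.card_fin, nsmul_eq_mul]
        congr 1
        refine Finset.sum_congr rfl fun i _ ↦ ?_
        congr 1; abel
      rw [this]
      have h3 : ∑ b ∈ A, F (x - b) = (∑ t ∈ A, ∑ t' ∈ A, f (x + t - t')) / A.card := by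
        rw [hF, ← Finset.sum_div, Finset.sum_comm]
        congr 1
        refine Finset.sum_congr rfl fun b _ ↦ Finset.sum_congr rfl fun i _ ↦ ?_
        congr 1; abel
      rw [h3, diffAvg]
      field_simp
    rw [e1, abs_le]
    have k1 := key l (.inl rfl)
    have k2 := key (-l) (.inr rfl)
    set q := (∑ b ∈ A, v (x - b) z) / A.card
    constructor
    · rw [le_div_iff₀ hn']; nlinarith
    · rw [div_le_iff₀ hn']; nlinarith

/-- Some translate of the diagonal meets `Z` often. -/
lemma exists_card_diagonal_translate {n : ℕ} (Z : Finset (Fin n → G)) :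
    ∃ w : Fin n → G, Z.card * Fintype.card G ≤
      Fintype.card G ^ n * (Finset.univ.filter fun t : G ↦ (fun i ↦ w i + t) ∈ Z).card := by
  have h : ∑ w : Fin n → G, (Finset.univ.filter fun t : G ↦ (fun i ↦ w i + t) ∈ Z).card =
      Z.card * Fintype.card G := by
    simp_rw [Finset.card_filter]
    rw [Finset.sum_comm]
    have : ∀ t : G, ∑ w : Fin n → G, (if (fun i ↦ w i + t) ∈ Z then 1 else 0) = Z.card := by
      intro t
      rw [← Equiv.sum_comp (Equiv.addRight (fun _ : Fin n ↦ -t))]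
      simp
    simp [this, mul_comm]
  by_contra! hlt
  have h2 := Finset.sum_lt_sum_of_nonempty (s := (Finset.univ : Finset (Fin n → G)))
    Finset.univ_nonempty fun w _ ↦ hlt w
  rw [← Finset.mul_sum, h] at h2
  simp at h2

/-- Uniform almost-periodicity of `diffAvg A f` (Croot and Sisask). -/
lemma exists_almostPeriods {A : Finset G} (hA : A.Nonempty) {f : G → ℝ}
    (hf0 : ∀ x, 0 ≤ f x) (hf1 : ∀ x, f x ≤ 1) {n : ℕ} (hn : 0 < n) {l : ℝ} (hl : 0 < l)
    (hnl : 2 * Real.log (4 * (Fintype.card G / A.card)) ≤ l ^ 2 * n) :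
    ∃ X : Finset G, (Fintype.card G : ℝ) ≤ 2 * ((Fintype.card G / A.card : ℝ) ^ n * X.card) ∧
      ∀ x, ∀ t ∈ X, ∀ t' ∈ X, |diffAvg A f (x + t - t') - diffAvg A f x| ≤ 2 * l := by
  have hc : (0 : ℝ) < A.card := by exact_mod_cast hA.card_pos
  have hG : (0 : ℝ) < Fintype.card G := by exact_mod_cast Fintype.card_pos
  obtain ⟨Z, hZ, hZx⟩ := exists_uniform_samples hA hf0 hf1 hn hl hnl
  obtain ⟨w, hw⟩ := exists_card_diagonal_translate Z
  set X := Finset.univ.filter fun t : G ↦ (fun i ↦ w i + t) ∈ Z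
  refine ⟨X, ?_, fun x t ht t' ht' ↦ ?_⟩
  · have hw' : (Z.card : ℝ) * Fintype.card G ≤ (Fintype.card G : ℝ) ^ n * X.card := by
      exact_mod_cast hw
    rw [div_pow, div_mul_eq_mul_div, ← mul_div_assoc, le_div_iff₀ (by positivity)]
    nlinarith
  · have h1 := hZx _ (Finset.mem_filter.1 ht).2 x
    have h2 := hZx _ (Finset.mem_filter.1 ht').2 (x + t - t')
    -- The sample w + t at x and the sample w + t' at x + t - t' give the same empirical average,
    -- which is close to both values of `diffAvg`.
    have e : ∀ b i, x + t - t' + (w i + t') - b = x + (w i + t) - b := fun b i ↦ by abel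
    simp only [e] at h2
    rw [abs_le] at h1 h2 ⊢
    constructor <;> linarith
end

/-! ### Chang's inequality and the large spectrum. -/

section
variable {G : Type*} [AddCommGroup G] [Fintype G]

/-- **Chang's inequality**: dissociated sets of large Fourier coefficients are small. -/
lemma card_le_of_addDissociated {X : Finset G} (hX : X.Nonempty) {D : Finset (AddChar G ℂ)}
    (hD : AddDissociated (D : Set (AddChar G ℂ)))
    (hDX : ∀ γ ∈ D, (X.card : ℝ) / 2 ≤ ‖∑ x ∈ X, γ x‖) :
    (D.card : ℝ) ≤ 8 * Real.log (Fintype.card G / X.card) := by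
  classical
  have hc : (0 : ℝ) < X.card := by exact_mod_cast hX.card_pos
  have hG : (0 : ℝ) < Fintype.card G := by exact_mod_cast Fintype.card_pos
  have hph : ∀ γ : AddChar G ℂ, ∃ c : ℂ, ‖c‖ = 1 ∧
      (c * ∑ x ∈ X, γ x).re = ‖∑ x ∈ X, γ x‖ := by
    intro γ
    set s := ∑ x ∈ X, γ x
    by_cases hs : s = 0
    · exact ⟨1, by simp, by simp [hs]⟩
    · have hs' : (‖s‖ : ℂ) ≠ 0 := by exact_mod_cast (norm_pos_iff.2 hs).ne'
      refine ⟨starRingEnd ℂ s / ‖s‖, by simp [hs], ?_⟩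
      rw [div_mul_eq_mul_div, mul_comm, Complex.mul_conj, Complex.normSq_eq_norm_sq]
      rw [show (((‖s‖ ^ 2 : ℝ) : ℂ) / ‖s‖) = ((‖s‖ : ℝ) : ℂ) by push_cast; field_simp]
      simp
  choose c hc1 hcre using hph
  have hle : ∀ γ x, |(c γ * γ x).re| ≤ 1 := fun γ x ↦
    (Complex.abs_re_le_norm _).trans (by simp [hc1])
  -- This maximises l/2 - l²/2; the value 1/8 becomes the factor 8.
  set l : ℝ := 1 / 2
  set d : AddChar G ℂ → ℂ := fun γ ↦ if γ ∈ D then (Real.sinh l : ℂ) * c γ else 0 with hd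
  set e : AddChar G ℂ → ℝ := fun γ ↦ if γ ∈ D then Real.cosh l else 1 with he
  -- Riesz product: by dissociativity only the constant terms contribute to the mean.
  have hrand := AddDissociated.randomisation e d (hD.subset fun γ hγ ↦ by
    by_contra h; simp [hd] at hγ h; exact h hγ.1)
  have hprod : ∏ γ, e γ = Real.cosh l ^ D.card := by
    simp [he, Finset.prod_ite_mem]
  have hpt : ∀ x, Real.exp (∑ γ ∈ D, l * (c γ * γ x).re) ≤
      ∏ γ, (e γ + (d γ * γ x).re) := by
    intro x
    rw [Real.exp_sum]
    have : ∏ γ, (e γ + (d γ * γ x).re) =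
        ∏ γ ∈ D, (Real.cosh l + (c γ * γ x).re * Real.sinh l) := by
      rw [← Finset.prod_subset (Finset.subset_univ D)]
      · refine Finset.prod_congr rfl fun γ hγ ↦ ?_
        simp only [he, hd, if_pos hγ]
        rw [mul_assoc, Complex.re_ofReal_mul, mul_comm (Real.sinh l)]
      · intro γ _ hγ; simp [he, hd, hγ]
    rw [this]
    exact Finset.prod_le_prod (fun _ _ ↦ (Real.exp_pos _).le) fun γ _ ↦
      exp_mul_le_cosh_add_mul_sinh_of_abs_le (hle γ x) l
  have hlow : l * (D.card / 2) ≤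
      (∑ x ∈ X, ∑ γ ∈ D, l * (c γ * γ x).re) / X.card := by
    rw [Finset.sum_comm, le_div_iff₀ hc]
    calc _ = ∑ γ ∈ D, l * (X.card / 2 : ℝ) := by simp; ring
      _ ≤ _ := by
        refine Finset.sum_le_sum fun γ hγ ↦ ?_
        rw [← Finset.mul_sum, ← Complex.re_sum, ← Finset.mul_sum, hcre]
        gcongr
        exact hDX γ hγ
  have hup : Real.exp (l * (D.card / 2)) ≤
      (Fintype.card G / X.card) * Real.exp (l ^ 2 / 2 * D.card) := by
    calc _ ≤ Real.exp ((∑ x ∈ X, ∑ γ ∈ D, l * (c γ * γ x).re) / X.card) :=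
          Real.exp_le_exp.2 hlow
      _ ≤ (∑ x ∈ X, Real.exp (∑ γ ∈ D, l * (c γ * γ x).re)) / X.card :=
          exp_sum_div_card_le hX _
      _ ≤ (∑ x, ∏ γ, (e γ + (d γ * γ x).re)) / X.card := by
          gcongr
          exact (Finset.sum_le_sum_of_subset_of_nonneg (Finset.subset_univ _)
            fun _ _ _ ↦ (Real.exp_pos _).le).trans (Finset.sum_le_sum fun x _ ↦ hpt x)
      _ = (Fintype.card G / X.card) * Real.cosh l ^ D.card := by
          rw [← hprod, ← hrand, Fintype.expect_eq_sum_div_card]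
          field_simp
      _ ≤ (Fintype.card G / X.card) * Real.exp (l ^ 2 / 2) ^ D.card := by
          gcongr
          exact Real.cosh_le_exp_half_sq l
      _ = _ := by rw [← Real.exp_nat_mul]; congr 2; ring
  have := (Real.le_log_iff_exp_le (by positivity)).2 hup
  rw [Real.log_mul (by positivity) (by positivity), Real.log_exp] at this
  simp only [l] at this
  linarith

lemma norm_prod_sub_one_le {ι : Type*} (s : Finset ι) (z : ι → ℂ) (hz : ∀ i ∈ s, ‖z i‖ = 1)
    {δ : ℝ} (h : ∀ i ∈ s, ‖z i - 1‖ ≤ δ) : ‖∏ i ∈ s, z i - 1‖ ≤ s.card * δ := by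
  classical
  induction s using Finset.induction_on with
  | empty => simp
  | insert a s ha ih =>
    rw [Finset.prod_insert ha, Finset.card_insert_of_notMem ha]
    have h1 := ih (fun i hi ↦ hz i (Finset.mem_insert_of_mem hi))
      (fun i hi ↦ h i (Finset.mem_insert_of_mem hi))
    have h2 := h a (Finset.mem_insert_self a s)
    have h3 := hz a (Finset.mem_insert_self a s)
    calc _ = ‖z a * (∏ i ∈ s, z i - 1) + (z a - 1)‖ := by congr 1; ring
      _ ≤ ‖z a * (∏ i ∈ s, z i - 1)‖ + ‖z a - 1‖ := norm_add_le _ _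
      _ ≤ s.card * δ + δ := by rw [norm_mul, h3, one_mul]; exact add_le_add h1 h2
      _ = _ := by push_cast; ring

lemma norm_sub_one_le_of_mem_addSpan {D : Finset (AddChar G ℂ)} [DecidableEq (AddChar G ℂ)]
    {γ : AddChar G ℂ} (hγ : γ ∈ Finset.addSpan D) {δ : ℝ} {x : G} (hx : x ∈ bohrSet D δ) :
    ‖γ x - 1‖ ≤ D.card * δ := by
  obtain ⟨ε, hε, rfl⟩ := Finset.mem_addSpan.1 hγ
  rw [AddChar.sum_apply]
  refine norm_prod_sub_one_le _ _ (fun i _ ↦ by simp) fun i hi ↦ ?_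
  have h := hx i hi
  rw [AddChar.zsmul_apply]
  rcases hε i with h' | h' | h' <;> rw [h']
  · have : (i x) ^ (-1 : ℤ) - 1 = - (i x)⁻¹ * (i x - 1) := by
      have : i x ≠ 0 := by rw [← norm_pos_iff]; simp
      field_simp; simp
    rw [this]; simpa using h
  · simpa using (norm_nonneg _).trans h
  · simpa using h

/-- The large spectrum is controlled by a Bohr set of small rank. -/
lemma exists_bohrSet_controlling_spectrum {X : Finset G} (hX : X.Nonempty) :
    ∃ D : Finset (AddChar G ℂ), (D.card : ℝ) ≤ 8 * Real.log (Fintype.card G / X.card) ∧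
      ∀ (δ : ℝ), ∀ x ∈ bohrSet D δ, ∀ γ : AddChar G ℂ,
        (X.card : ℝ) / 2 ≤ ‖∑ x ∈ X, γ x‖ → ‖γ x - 1‖ ≤ D.card * δ := by
  classical
  set S := Finset.univ.filter fun γ : AddChar G ℂ ↦ (X.card : ℝ) / 2 ≤ ‖∑ x ∈ X, γ x‖
  have hS : ∀ D ⊆ S, AddDissociated (D : Set (AddChar G ℂ)) →
      D.card ≤ ⌊8 * Real.log (Fintype.card G / X.card)⌋₊ := fun D hDS hD ↦
    Nat.le_floor (card_le_of_addDissociated hX hD fun γ hγ ↦ (Finset.mem_filter.1 (hDS hγ)).2)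
  obtain ⟨D, hDS, hD, hSD⟩ := Finset.exists_subset_addSpan_card_le_of_forall_addDissociated hS
  refine ⟨D, (Nat.le_floor_iff ?_).1 hD,
    fun δ x hx γ hγ ↦ norm_sub_one_le_of_mem_addSpan (hSD (by simpa [S] using hγ)) hx⟩
  have hc : (0 : ℝ) < X.card := by exact_mod_cast hX.card_pos
  refine mul_nonneg (by norm_num) (Real.log_nonneg ((one_le_div hc).2 ?_))
  exact_mod_cast X.card_le_univ
end

/-! ### Fourier analysis of the averages. -/

section
variable {G : Type*} [AddCommGroup G] [Fintype G]

lemma re_sum_addChar [DecidableEq G] (a : G) :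
    ∑ γ : AddChar G ℂ, (γ a).re = if a = 0 then (Fintype.card G : ℝ) else 0 := by
  rw [← Complex.re_sum, AddChar.sum_apply_eq_ite]
  split_ifs <;> simp

/-- The cosine coefficient of a real function. -/
noncomputable def cosCoeff (f : G → ℝ) (γ : AddChar G ℂ) : ℝ :=
  (∑ y, f y * (γ y).re) / Fintype.card G

/-- Fourier inversion for even functions. -/
lemma sum_cosCoeff_mul_re {f : G → ℝ} (hf : ∀ x, f (-x) = f x) (x : G) :
    ∑ γ, cosCoeff f γ * (γ x).re = f x := by
  classical
  have hG : (Fintype.card G : ℝ) ≠ 0 := by exact_mod_cast Fintype.card_pos.ne'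
  have h2 : ∀ (γ : AddChar G ℂ) y, (γ y).re * (γ x).re = ((γ (y + x)).re + (γ (y - x)).re) / 2 := by
    intro γ y
    rw [sub_eq_add_neg, AddChar.map_add_eq_mul, AddChar.map_add_eq_mul, AddChar.map_neg_eq_conj]
    simp
  calc _ = (∑ y, f y * ∑ γ : AddChar G ℂ, (γ y).re * (γ x).re) / Fintype.card G := by
        simp_rw [cosCoeff, div_mul_eq_mul_div, ← Finset.sum_div, Finset.sum_mul, Finset.mul_sum]
        rw [Finset.sum_comm]; simp_rw [mul_assoc]
    _ = (∑ y, f y * (((if y = -x then (Fintype.card G : ℝ) else 0) +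
          if y = x then (Fintype.card G : ℝ) else 0) / 2)) / Fintype.card G := by
        simp_rw [h2, ← Finset.sum_div, Finset.sum_add_distrib, re_sum_addChar,
          add_eq_zero_iff_eq_neg, sub_eq_zero]
    _ = _ := by
        simp_rw [mul_div_assoc', mul_add, ← Finset.sum_div, Finset.sum_add_distrib]
        simp [hf]

lemma sum_cosCoeff_sq {f : G → ℝ} (hf : ∀ x, f (-x) = f x) :
    ∑ γ, cosCoeff f γ ^ 2 = (∑ x, f x ^ 2) / Fintype.card G := by
  calc _ = ∑ γ, (∑ y, cosCoeff f γ * (f y * (γ y).re)) / Fintype.card G := by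
        refine Finset.sum_congr rfl fun γ _ ↦ ?_
        rw [← Finset.mul_sum, sq, mul_div_assoc]; rfl
    _ = (∑ y, f y * ∑ γ, cosCoeff f γ * (γ y).re) / Fintype.card G := by
        rw [← Finset.sum_div, Finset.sum_comm]
        simp_rw [Finset.mul_sum, mul_left_comm]
    _ = _ := by simp_rw [sum_cosCoeff_mul_re hf, sq]

lemma sum_sum_re_addChar (X : Finset G) (γ : AddChar G ℂ) (x : G) :
    ∑ t ∈ X, ∑ t' ∈ X, (γ (x + t - t')).re = ‖∑ t ∈ X, γ t‖ ^ 2 * (γ x).re := by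
  have : ∑ t ∈ X, ∑ t' ∈ X, γ (x + t - t') = ((‖∑ t ∈ X, γ t‖ ^ 2 : ℝ) : ℂ) * γ x := by
    rw [← Complex.normSq_eq_norm_sq, ← Complex.mul_conj, map_sum, Finset.sum_mul_sum,
      Finset.sum_mul]
    refine Finset.sum_congr rfl fun t _ ↦ ?_
    rw [Finset.sum_mul]
    refine Finset.sum_congr rfl fun t' _ ↦ ?_
    rw [sub_eq_add_neg, AddChar.map_add_eq_mul, AddChar.map_add_eq_mul, AddChar.map_neg_eq_conj]
    ring
  rw [← Complex.re_ofReal_mul, ← this]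
  simp

/-- `diffAvg X` acts diagonally on cosine expansions. -/
lemma diffAvg_cos (X : Finset G) (w : AddChar G ℂ → ℝ) (x : G) :
    diffAvg X (fun x ↦ ∑ γ, w γ * (γ x).re) x =
      ∑ γ, (w γ * (‖∑ t ∈ X, γ t‖ / X.card) ^ 2) * (γ x).re := by
  have : ∀ t ∈ X, ∑ t' ∈ X, ∑ γ : AddChar G ℂ, w γ * (γ (x + t - t')).re =
      ∑ γ : AddChar G ℂ, ∑ t' ∈ X, w γ * (γ (x + t - t')).re := fun t _ ↦ Finset.sum_comm
  rw [diffAvg, Finset.sum_congr rfl this, Finset.sum_comm, Finset.sum_div]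
  refine Finset.sum_congr rfl fun γ _ ↦ ?_
  simp_rw [← Finset.mul_sum, sum_sum_re_addChar, div_pow]
  ring

lemma diffAvg_iterate_cos (X : Finset G) (w : AddChar G ℂ → ℝ) (k : ℕ) :
    (diffAvg X)^[k] (fun x ↦ ∑ γ, w γ * (γ x).re) =
      fun x ↦ ∑ γ, (w γ * (‖∑ t ∈ X, γ t‖ / X.card) ^ (2 * k)) * (γ x).re := by
  induction k with
  | zero => simp
  | succ k ih =>
    rw [Function.iterate_succ_apply', ih]
    funext x
    rw [diffAvg_cos]
    refine Finset.sum_congr rfl fun γ _ ↦ ?_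
    ring

lemma norm_sum_addChar_div_card_le (X : Finset G) (γ : AddChar G ℂ) :
    ‖∑ t ∈ X, γ t‖ / X.card ≤ 1 := by
  refine div_le_one_of_le₀ ((norm_sum_le _ _).trans ?_) (by positivity)
  simp

lemma sum_norm_sum_addChar_sq {A : Finset G} (hA : A.Nonempty) :
    ∑ γ : AddChar G ℂ, (‖∑ t ∈ A, γ t‖ / A.card) ^ 2 = Fintype.card G / A.card := by
  classical
  have hc : (0 : ℝ) < A.card := by exact_mod_cast hA.card_pos
  have h : ∑ γ : AddChar G ℂ, ‖∑ t ∈ A, γ t‖ ^ 2 = Fintype.card G * A.card := by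
    have h1 : ∀ γ : AddChar G ℂ, ‖∑ t ∈ A, γ t‖ ^ 2 = ∑ t ∈ A, ∑ t' ∈ A, (γ (t - t')).re := by
      intro γ
      have := sum_sum_re_addChar A γ 0
      simpa using this.symm
    simp_rw [h1]
    rw [Finset.sum_comm]
    have h2 : ∀ t ∈ A, ∑ γ : AddChar G ℂ, ∑ t' ∈ A, (γ (t - t')).re = Fintype.card G := by
      intro t ht
      rw [Finset.sum_comm]
      simp_rw [re_sum_addChar, sub_eq_zero]
      simp [ht]
    rw [Finset.sum_congr rfl h2]; simp [mul_comm]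
  simp_rw [div_pow]
  rw [← Finset.sum_div, h]
  field_simp

/-- One factor of the transform of A is dropped, being at most 1; Cauchy–Schwarz and Parseval for f
and for A then give √ρ rather than ρ. -/
lemma sum_abs_cosCoeff_mul_le {A : Finset G} (hA : A.Nonempty) {f : G → ℝ}
    (hf : ∀ x, f (-x) = f x) (hf0 : ∀ x, 0 ≤ f x) (hf1 : ∀ x, f x ≤ 1) :
    ∑ γ, |cosCoeff f γ| * (‖∑ t ∈ A, γ t‖ / A.card) ^ 2 ≤
      Real.sqrt (Fintype.card G / A.card) := by
  have hG : (0 : ℝ) < Fintype.card G := by exact_mod_cast Fintype.card_pos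
  have h1 : ∑ γ, |cosCoeff f γ| ^ 2 ≤ 1 := by
    simp_rw [sq_abs]
    rw [sum_cosCoeff_sq hf, div_le_one hG]
    simpa using Finset.sum_le_sum (s := Finset.univ) fun x _ ↦ pow_le_one₀ (n := 2) (hf0 x) (hf1 x)
  calc _ ≤ ∑ γ, |cosCoeff f γ| * (‖∑ t ∈ A, γ t‖ / A.card) := by
        gcongr with γ
        exact pow_le_of_le_one (by positivity) (norm_sum_addChar_div_card_le A γ) two_ne_zero
    _ ≤ Real.sqrt (∑ γ, |cosCoeff f γ| ^ 2) *
        Real.sqrt (∑ γ : AddChar G ℂ, (‖∑ t ∈ A, γ t‖ / A.card) ^ 2) :=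
        Real.sum_mul_le_sqrt_mul_sqrt _ _ _
    _ ≤ 1 * Real.sqrt (Fintype.card G / A.card) := by
        rw [sum_norm_sum_addChar_sq hA]
        gcongr
        exact Real.sqrt_le_one.2 h1
    _ = _ := one_mul _

end

lemma abs_diffAvg_iterate_sub_le {G : Type*} [AddCommGroup G] {X : Finset G}
    (hX : X.Nonempty) {u : G → ℝ} {η : ℝ}
    (h : ∀ x, ∀ t ∈ X, ∀ t' ∈ X, |u (x + t - t') - u x| ≤ η) (k : ℕ) (x : G) :
    |(diffAvg X)^[k] u x - u x| ≤ k * η := by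
  have hc : (0 : ℝ) < X.card := by exact_mod_cast hX.card_pos
  induction k generalizing x with
  | zero => simp
  | succ k ih =>
    rw [Function.iterate_succ_apply', diffAvg]
    have e : (∑ t ∈ X, ∑ t' ∈ X, (diffAvg X)^[k] u (x + t - t')) / (X.card : ℝ) ^ 2 - u x =
        (∑ t ∈ X, ∑ t' ∈ X, ((diffAvg X)^[k] u (x + t - t') - u x)) / (X.card : ℝ) ^ 2 := by
      simp only [Finset.sum_sub_distrib, Finset.sum_const, nsmul_eq_mul]
      field_simp
    rw [e, abs_div, abs_of_pos (by positivity : (0 : ℝ) < (X.card : ℝ) ^ 2),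
      div_le_iff₀ (by positivity)]
    calc _ ≤ ∑ t ∈ X, ∑ t' ∈ X, |(diffAvg X)^[k] u (x + t - t') - u x| :=
          (Finset.abs_sum_le_sum_abs _ _).trans
            (Finset.sum_le_sum fun t _ ↦ Finset.abs_sum_le_sum_abs _ _)
      _ ≤ ∑ t ∈ X, ∑ t' ∈ X, (k * η + η) := by
          refine Finset.sum_le_sum fun t ht ↦ Finset.sum_le_sum fun t' ht' ↦ ?_
          exact (abs_sub_le _ (u (x + t - t')) _).trans (add_le_add (ih _) (h x t ht t' ht'))
      _ = _ := by simp; ring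

/-- The loss from a large-spectrum character is thus quadratic in its distance from 1, which is what
the radius relies on. -/
lemma one_sub_re_eq {z : ℂ} (hz : ‖z‖ = 1) : 1 - z.re = ‖z - 1‖ ^ 2 / 2 := by
  have h1 : z.re ^ 2 + z.im ^ 2 = 1 := by
    have := Complex.sq_norm z; rw [hz, Complex.normSq_apply] at this; nlinarith
  rw [Complex.sq_norm, Complex.normSq_apply]; simp; nlinarith

/-- The iterated average of an even function varies little on a Bohr set controlling the
large spectrum. -/
lemma diffAvg_iterate_zero_sub_le {G : Type*} [AddCommGroup G] [Fintype G]
    {A X : Finset G} (hA : A.Nonempty) {f : G → ℝ}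
    (hf : ∀ x, f (-x) = f x) (hf0 : ∀ x, 0 ≤ f x) (hf1 : ∀ x, f x ≤ 1) (k : ℕ) {θ ε : ℝ} {x : G}
    (hx : ∀ γ : AddChar G ℂ, (X.card : ℝ) / 2 ≤ ‖∑ x ∈ X, γ x‖ → ‖γ x - 1‖ ≤ θ)
    (hθ : θ ^ 2 / 2 * Real.sqrt (Fintype.card G / A.card) ≤ ε)
    (hk : 2 * (1 / 4) ^ k * Real.sqrt (Fintype.card G / A.card) ≤ ε) :
    (diffAvg X)^[k] (diffAvg A f) 0 - (diffAvg X)^[k] (diffAvg A f) x ≤ ε := by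
  set r := Real.sqrt (Fintype.card G / A.card)
  set M := max (θ ^ 2 / 2) (2 * (1 / 4) ^ k) with hM
  have e : diffAvg A f = fun x ↦ ∑ γ, (cosCoeff f γ * (‖∑ t ∈ A, γ t‖ / A.card) ^ 2) * (γ x).re := by
    funext x
    rw [← diffAvg_cos]
    congr 1
    funext y
    exact (sum_cosCoeff_mul_re hf y).symm
  rw [e, diffAvg_iterate_cos, ← Finset.sum_sub_distrib]
  calc _ ≤ ∑ γ, (|cosCoeff f γ| * (‖∑ t ∈ A, γ t‖ / A.card) ^ 2) * M := by
        refine Finset.sum_le_sum fun γ _ ↦ ?_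
        set p := ‖∑ t ∈ X, γ t‖ / X.card with hp
        have hp0 : 0 ≤ p := by positivity
        have hp1 : p ≤ 1 := norm_sum_addChar_div_card_le X γ
        have hn : ‖γ x‖ = 1 := by simp
        have h0 : 0 ≤ 1 - (γ x).re := by rw [one_sub_re_eq hn]; positivity
        have h2 : 1 - (γ x).re ≤ 2 := by
          have := (abs_le.1 ((Complex.abs_re_le_norm (γ x)).trans hn.le)).1
          linarith
        -- Large spectrum: x is nearly invisible to γ. Elsewhere p < 1/2, and the power 2k
        -- suppresses the term.
        have hmain : p ^ (2 * k) * (1 - (γ x).re) ≤ M := by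
          by_cases hs : (X.card : ℝ) / 2 ≤ ‖∑ x ∈ X, γ x‖
          · refine le_trans ?_ (le_max_left _ _)
            calc _ ≤ 1 * (1 - (γ x).re) := by gcongr; exact pow_le_one₀ hp0 hp1
              _ = ‖γ x - 1‖ ^ 2 / 2 := by rw [one_mul, one_sub_re_eq hn]
              _ ≤ _ := by gcongr; exact hx γ hs
          · refine le_trans ?_ (le_max_right _ _)
            have hp2 : p ≤ 1 / 2 := div_le_of_le_mul₀ (by positivity) (by norm_num) (by linarith)
            calc p ^ (2 * k) * (1 - (γ x).re) ≤ (1 / 2) ^ (2 * k) * 2 := by gcongr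
              _ = 2 * (1 / 4) ^ k := by
                rw [pow_mul, mul_comm, show ((1 : ℝ) / 2) ^ 2 = 1 / 4 by norm_num]
        simp only [AddChar.map_zero_eq_one, Complex.one_re, mul_one]
        calc _ = cosCoeff f γ * (‖∑ t ∈ A, γ t‖ / A.card) ^ 2 * (p ^ (2 * k) * (1 - (γ x).re)) := by
              ring
          _ ≤ |cosCoeff f γ| * (‖∑ t ∈ A, γ t‖ / A.card) ^ 2 * (p ^ (2 * k) * (1 - (γ x).re)) := by
              gcongr; exact le_abs_self _
          _ ≤ _ := by gcongr
    _ ≤ r * M := by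
        rw [← Finset.sum_mul]
        gcongr
        exact sum_abs_cosCoeff_mul_le hA hf hf0 hf1
    _ ≤ ε := by
        rcases max_choice (θ ^ 2 / 2) (2 * (1 / 4 : ℝ) ^ k) with h | h <;> rw [hM, h, mul_comm] <;>
          assumption

/-! ### Assembly and choice of parameters. -/

section
variable {G : Type*} [AddCommGroup G] [DecidableEq G]

lemma diffAvg_indicator_sub_zero {A : Finset G} (hA : A.Nonempty) :
    diffAvg A (fun x ↦ if x ∈ A - A then 1 else 0) 0 = 1 := by
  have hc : (A.card : ℝ) ≠ 0 := by exact_mod_cast hA.card_pos.ne'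
  have : ∀ t ∈ A, ∑ t' ∈ A, (if 0 + t - t' ∈ A - A then (1 : ℝ) else 0) = A.card := by
    intro t ht
    rw [Finset.sum_congr rfl fun t' ht' ↦ if_pos (by
      rw [zero_add]; exact Finset.sub_mem_sub ht ht')]
    simp
  rw [diffAvg, Finset.sum_congr rfl this]
  simp; field_simp

lemma mem_of_diffAvg_indicator_pos {A : Finset G} {x : G}
    (h : 0 < diffAvg A (fun x ↦ if x ∈ A - A then 1 else 0) x) : x ∈ A + A - A - A := by
  by_contra hx
  refine h.ne' ?_
  rw [diffAvg, Finset.sum_eq_zero, zero_div]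
  refine fun t ht ↦ Finset.sum_eq_zero fun t' ht' ↦ if_neg fun hm ↦ hx ?_
  obtain ⟨a, ha, b, hb, hab⟩ := Finset.mem_sub.1 hm
  have : x = a + t' - b - t := by
    rw [show x = (x + t - t') + t' - t by abel, ← hab]; abel
  rw [this]
  exact Finset.sub_mem_sub (Finset.sub_mem_sub (Finset.add_mem_add ha ht') hb) ht

variable [Fintype G]

/-- `2A - 2A` contains a Bohr set, with explicit parameters. -/
lemma exists_bohrSet_subset {A : Finset G} (hA : A.Nonempty) {k n : ℕ} (hk : 0 < k) (hn : 0 < n)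
    (hkn : 2 * Real.log (4 * (Fintype.card G / A.card)) ≤ (1 / (8 * k : ℝ)) ^ 2 * n)
    (hkA : 16 * Real.sqrt (Fintype.card G / A.card) ≤ 4 ^ k) :
    ∃ Γ : Finset (AddChar G ℂ),
      (Γ.card : ℝ) ≤ 8 * Real.log (2 * (Fintype.card G / A.card : ℝ) ^ n) ∧
      ∀ δ : ℝ, 4 * Real.sqrt (Fintype.card G / A.card) * (Γ.card * δ) ^ 2 ≤ 1 →
        bohrSet Γ δ ⊆ ((A + A - A - A : Finset G) : Set G) := by
  have hc : (0 : ℝ) < A.card := by exact_mod_cast hA.card_pos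
  have hG : (0 : ℝ) < Fintype.card G := by exact_mod_cast Fintype.card_pos
  have hk' : (0 : ℝ) < k := by exact_mod_cast hk
  set f : G → ℝ := fun x ↦ if x ∈ A - A then 1 else 0 with hf
  have hf0 : ∀ x, 0 ≤ f x := fun x ↦ by simp only [hf]; split_ifs <;> norm_num
  have hf1 : ∀ x, f x ≤ 1 := fun x ↦ by simp only [hf]; split_ifs <;> norm_num
  have hfs : ∀ x, f (-x) = f x := fun x ↦ by
    have h : -x ∈ A - A ↔ x ∈ A - A := by rw [← Finset.mem_neg', neg_sub]
    simp only [hf, h]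
  obtain ⟨X, hXc, hX⟩ := exists_almostPeriods hA hf0 hf1 hn (by positivity) hkn
  have hXne : X.Nonempty := by
    rw [Finset.nonempty_iff_ne_empty]; rintro rfl; simp at hXc
  have hXc' : (0 : ℝ) < X.card := by exact_mod_cast hXne.card_pos
  obtain ⟨Γ, hΓ, hΓX⟩ := exists_bohrSet_controlling_spectrum hXne
  refine ⟨Γ, hΓ.trans ?_, fun δ hδ x hx ↦ ?_⟩
  · gcongr
    rw [div_le_iff₀ hXc']
    linarith
  · refine Finset.mem_coe.2 (mem_of_diffAvg_indicator_pos ?_)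
    set r := Real.sqrt (Fintype.card G / A.card) with hr
    have hv := diffAvg_iterate_zero_sub_le (X := X) hA hfs hf0 hf1 k (ε := 1 / 8) (hΓX δ x hx)
      (by linarith) (by
        rw [one_div_pow, mul_one_div, div_mul_eq_mul_div, div_le_iff₀ (by positivity)]
        linarith)
    have h1 := diffAvg_indicator_sub_zero hA
    have h2 := abs_diffAvg_iterate_sub_le hXne hX k
    -- With l = 1/(8k), smoothing costs 1/4 at 0 and at x, and moving from 0 to x costs 1/8, so the
    -- value at x is at least 1 - 1/4 - 1/8 - 1/4 = 3/8.
    have h3 : (k : ℝ) * (2 * (1 / (8 * k))) = 1 / 4 := by field_simp; norm_num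
    have h4 := (abs_le.1 (h2 0)).1
    have h5 := (abs_le.1 (h2 x)).2
    rw [h3] at h4 h5
    change 0 < diffAvg A f x
    change diffAvg A f 0 = 1 at h1
    linarith

/-- If `A` has more than half of the elements of `G` then `2A - 2A = G`. -/
lemma mem_add_sub_sub_of_card_lt {A : Finset G} (h : Fintype.card G < 2 * A.card) (x : G) :
    x ∈ A + A - A - A := by
  have hA : A.Nonempty := Finset.card_pos.1 (by omega)
  obtain ⟨a, ha⟩ := hA
  have hi : ((A.image (x + ·)) ∩ A).Nonempty := by
    refine Finset.inter_nonempty_of_card_lt_card_add_card (Finset.subset_univ _)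
      (Finset.subset_univ _) ?_
    rw [Finset.card_image_of_injective _ (add_right_injective x), Finset.card_univ]
    omega
  obtain ⟨y, hy⟩ := hi
  obtain ⟨hy1, hy2⟩ := Finset.mem_inter.1 hy
  obtain ⟨b, hb, rfl⟩ := Finset.mem_image.1 hy1
  rw [show x = (x + b) + a - b - a by abel]
  exact Finset.sub_mem_sub (Finset.sub_mem_sub (Finset.add_mem_add hy2 ha) hb) ha

/-- Choice of the parameters for density at most one half. -/
lemma exists_parameters {ρ : ℝ} (hρ : 2 ≤ ρ) :
    ∃ k n : ℕ, 0 < k ∧ 0 < n ∧ 2 * Real.log (4 * ρ) ≤ (1 / (8 * k : ℝ)) ^ 2 * n ∧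
      16 * Real.sqrt ρ ≤ 4 ^ k ∧ 8 * Real.log (2 * ρ ^ n) ≤ 110656 * Real.log ρ ^ 4 := by
  set L := Real.log ρ with hL
  have hlog2 : Real.log 2 ≤ L := Real.log_le_log (by norm_num) hρ
  have hL69 : 0.69 ≤ L := by linarith [Real.log_two_gt_d9]
  have hlog4 : Real.log (4 * ρ) ≤ 3 * L := by
    rw [Real.log_mul (by norm_num) (by positivity), show (4 : ℝ) = 2 ^ 2 by norm_num,
      Real.log_pow]
    push_cast; linarith
  have hlog4' : 0 < Real.log (4 * ρ) := Real.log_pos (by linarith)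
  -- The extra 2 absorbs the factor 16 = 4², and 4^⌈L⌉ ≥ e^L = ρ ≥ √ρ.
  set k := ⌈L⌉₊ + 2 with hk
  have hkL : (k : ℝ) ≤ 6 * L := by
    have := (Nat.ceil_lt_add_one (by linarith : 0 ≤ L)).le
    rw [hk]; push_cast; linarith
  have hk0 : (0 : ℝ) < k := by positivity
  set n := ⌈2 * Real.log (4 * ρ) * (8 * k) ^ 2⌉₊ with hn
  have hL2 : 0.476 ≤ L ^ 2 := by nlinarith
  have hL3 : 0.328 ≤ L ^ 3 := by nlinarith
  -- 13828 = 6·48² + 4, where 4L³ covers the rounding. Below, 110656 = 8·13828 + 32, where 32L⁴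
  -- covers 8 log 2.
  have hnL : (n : ℝ) ≤ 13828 * L ^ 3 := by
    have h := (Nat.ceil_lt_add_one (by positivity : 0 ≤ 2 * Real.log (4 * ρ) * (8 * k : ℝ) ^ 2)).le
    have h2 : 2 * Real.log (4 * ρ) * (8 * k : ℝ) ^ 2 ≤ 2 * (3 * L) * (8 * (6 * L)) ^ 2 := by gcongr
    rw [← hn] at h
    nlinarith
  refine ⟨k, n, by omega, Nat.ceil_pos.2 (by positivity), ?_, ?_, ?_⟩
  · rw [one_div, inv_pow, inv_mul_eq_div, le_div_iff₀ (by positivity)]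
    exact Nat.le_ceil _
  · have h1 : ρ ≤ 4 ^ ⌈L⌉₊ := by
      calc ρ = Real.exp L := (Real.exp_log (by linarith)).symm
        _ ≤ Real.exp ⌈L⌉₊ := Real.exp_le_exp.2 (Nat.le_ceil _)
        _ = Real.exp 1 ^ ⌈L⌉₊ := by rw [← Real.exp_nat_mul, mul_one]
        _ ≤ _ := by gcongr; linarith [Real.exp_one_lt_d9]
    have h2 : Real.sqrt ρ ≤ ρ := Real.sqrt_le_iff.2 ⟨by linarith, by nlinarith⟩
    rw [hk, pow_add]
    linarith
  · rw [Real.log_mul (by norm_num) (by positivity), Real.log_pow]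
    have : n * L ≤ 13828 * L ^ 3 * L := by gcongr
    nlinarith

/-- The term y⁸/8! of the series of e^y at y = (log ρ)/2; the constant is 2⁸·8!. -/
lemma log_pow_eight_le {ρ : ℝ} (hρ : 1 ≤ ρ) : Real.log ρ ^ 8 ≤ 10321920 * Real.sqrt ρ := by
  have h := Real.pow_div_factorial_le_exp (Real.log ρ / 2)
    (by have := Real.log_nonneg hρ; positivity) 8
  rw [Real.exp_half, Real.exp_log (by linarith)] at h
  norm_num [Nat.factorial] at h
  linarith
end

theorem theorem7p4 :
    ∃ c C : ℝ, 0 < c ∧ 0 < C ∧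
      ∀ (G : Type*) [AddCommGroup G] [Fintype G] [DecidableEq G] (A : Finset G) (α : ℝ),
        A.Nonempty → (A.card : ℝ) = α * (Fintype.card G : ℝ) →
        ∃ (Γ : Finset (AddChar G ℂ)) (δ : ℝ),
          c * α ^ (1 / 2 : ℝ) ≤ δ ∧
          (Γ.card : ℝ) ≤ C * (Real.log (1 / α)) ^ 4 ∧
          bohrSet Γ δ ⊆ ((A + A - A - A : Finset G) : Set G) := by
  obtain ⟨R, hR⟩ : ∃ R : ℝ, R = 110656 := ⟨_, rfl⟩
  have hR0 : 0 < R := by rw [hR]; norm_num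
  refine ⟨1 / (8000 * R), R, by positivity, hR0, ?_⟩
  intro G _ _ _ A α hA hα
  have hc : (0 : ℝ) < A.card := by exact_mod_cast hA.card_pos
  have hG : (0 : ℝ) < Fintype.card G := by exact_mod_cast Fintype.card_pos
  -- Above density 1/2, log(1/α) may be too small to pay for any character, so rank 0 is used.
  rcases lt_or_ge (Fintype.card G) (2 * A.card) with h | h
  · refine ⟨∅, _, le_rfl, ?_, fun x _ ↦ Finset.mem_coe.2 (mem_add_sub_sub_of_card_lt h x)⟩
    rw [Finset.card_empty, Nat.cast_zero]
    positivity
  have hα' : α = A.card / Fintype.card G := by rw [hα]; field_simp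
  have hα0 : 0 < α := by rw [hα']; exact div_pos hc hG
  have hρ : (Fintype.card G / A.card : ℝ) = 1 / α := by rw [hα', one_div_div]
  have hρ2 : 2 ≤ 1 / α := by
    rw [← hρ, le_div_iff₀ hc]; exact_mod_cast h
  obtain ⟨k, n, hk, hn, h1, h2, h3⟩ := exists_parameters hρ2
  rw [← hρ] at h1 h2 h3
  obtain ⟨Γ, hΓ, hΓδ⟩ := exists_bohrSet_subset hA hk hn h1 h2
  rw [hρ, ← hR] at h3
  rw [hρ] at hΓ hΓδ
  have hcard := hΓ.trans h3
  refine ⟨Γ, _, le_rfl, hcard, hΓδ _ ?_⟩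
  set L := Real.log (1 / α)
  set s := Real.sqrt α with hs
  have hs0 : 0 < s := Real.sqrt_pos.2 hα0
  rw [← Real.sqrt_eq_rpow, ← hs]
  have hsq : Real.sqrt (1 / α) = 1 / s := by rw [Real.sqrt_div zero_le_one, Real.sqrt_one]
  have hL8 : L ^ 8 * s ≤ 10321920 := by
    have := log_pow_eight_le (by linarith : 1 ≤ 1 / α)
    rwa [hsq, mul_one_div, le_div_iff₀ hs0] at this
  rw [hsq]
  have hd0 : (0 : ℝ) ≤ Γ.card := Nat.cast_nonneg _
  generalize (Γ.card : ℝ) = d at hcard hd0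
  -- A radius of order α^(1/4)/L⁴ would do; α^(1/2) is affordable because L⁸√α is bounded.
  calc _ ≤ 4 * (1 / s) * (R * L ^ 4 * (1 / (8000 * R) * s)) ^ 2 := by gcongr
    _ = L ^ 8 * s / 16000000 := by field_simp; ring
    _ ≤ 1 := by linarith
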